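/- A countable Borel equivalence relation (CBER) on a Polish space $X$ is an equivalence relation $E$ on $X$ that is a Borel subset of $X^2$ and all of whose classes are countable; it is aperiodic if all its classes are infinite. For a countable group $G$, a Borel action of $G$ on $X/E$ is an action of $G$ on the set $X/E$ such that for every $g\in G$ the set $\{(x,y)\in X^2 : g\cdot[x]_E=[y]_E\}$ is Borel. Given such an action, let $E^{\vee G}$ be the equivalence relation on $X$ defined by $x\mathrel{E^{\vee G}}y\iff \exists g\in G\ (g\cdot[x]_E=[y]_E)$. If $Y\subseteq X$ is $E^{\vee G}$-invariant (a union of $E^{\vee G}$-classes), the action restricts to an action of $G$ on $Y/E$, where $Y/E$ is the quotient of $Y$ by $E\upharpoonright Y=E\cap Y^2$. **Corollary 1.2.** Let $E$ be an aperiodic CBER on a Polish space $X$ and let $G$ be a countable group. Then for any Borel action of $G$ on $X/E$ there is a comeager, $E^{\vee G}$-invariant Borel set $Y\subseteq X$ such that the restricted action of $G$ on $Y/E$ has a class-bijective lift, that is, there is an action of $G$ on $Y$ by Borel automorphisms of $E\upharpoonright Y$ (Borel bijections $T:Y\to Y$ with Borel inverse such that $x\mathrel E y\iff T(x)\mathrel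 E T(y)$) such that, for all $g\in G$ and $x\in Y$, $[g\cdot x]_E=g\cdot[x]_E$, and $g\cdot x\mathrel E x$ implies $g\cdot x=x$. -/

import Mathlib

/-- `E` is a countable Borel equivalence relation (CBER) on `X`: it is a Borel subset of `X × X`
and all of its classes are countable. -/
def IsCBER {X : Type*} [MeasurableSpace X] (E : Setoid X) : Prop :=
  MeasurableSet {p : X × X | E p.1 p.2} ∧ ∀ x : X, {y : X | E x y}.Countable

/-- `E` is aperiodic: every `E`-class is infinite. -/
def IsAperiodicRel {X : Type*} (E : Setoid X) : Prop :=
  ∀ x : X, {y : X | E x y}.Infinite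

/-- The `E`-saturation `[A]_E` of `A`. -/
def relSaturation {X : Type*} (E : Setoid X) (A : Set X) : Set X :=
  {x : X | ∃ y ∈ A, E x y}

/-- `A` is `E`-invariant: `A = [A]_E`. -/
def IsInvariantSet {X : Type*} (E : Setoid X) (A : Set X) : Prop :=
  A = relSaturation E A

/-- The restriction of `E` to a subset `Y`. -/
def restrictRel {X : Type*} (E : Setoid X) (Y : Set X) : Setoid Y :=
  E.comap Subtype.val

/-- A map `f : X/E → Y/F` is Borel if `{(x, y) | f [x]_E = [y]_F}` is a Borel subset of `X × Y`. -/
def IsBorelQuotientMap {X Y : Type*} [MeasurableSpace X] [MeasurableSpace Y]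
    (E : Setoid X) (F : Setoid Y) (f : Quotient E → Quotient F) : Prop :=
  MeasurableSet {p : X × Y | f (Quotient.mk E p.1) = Quotient.mk F p.2}

/-- An action of `G` on `X/E`, given as a morphism `ρ` into the permutations of `X/E`, is Borel if
`G` acts by Borel permutations. -/
def IsBorelQuotientAction {X G : Type*} [MeasurableSpace X] [Group G] (E : Setoid X)
    (ρ : G →* Equiv.Perm (Quotient E)) : Prop :=
  ∀ g : G, IsBorelQuotientMap E E (ρ g)

/-- The group `Aut_B(E)` of Borel automorphisms of `E`. -/
def borelAut {X : Type*} [MeasurableSpace X] (E : Setoid X) : Subgroup (Equiv.Perm X) where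
  carrier := {T | Measurable T ∧ Measurable T.symm ∧ ∀ x y : X, E x y ↔ E (T x) (T y)}
  one_mem' := ⟨measurable_id, measurable_id, fun _ _ => Iff.rfl⟩
  mul_mem' := by
    rintro S T ⟨hS, hS', hSE⟩ ⟨hT, hT', hTE⟩
    exact ⟨hS.comp hT, hT'.comp hS', fun x y => (hTE x y).trans (hSE (T x) (T y))⟩
  inv_mem' := by
    rintro T ⟨hT, hT', hTE⟩
    refine ⟨hT', hT, fun x y => ?_⟩
    simpa using (hTE (T.symm x) (T.symm y)).symm

/-- The equivalence relation `E^{∨G}`: `x` and `y` are related iff `g • [x]_E = [y]_E` for some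
`g ∈ G`. -/
def veeRel {X G : Type*} [Group G] (E : Setoid X) (ρ : G →* Equiv.Perm (Quotient E)) :
    Setoid X where
  r x y := ∃ g : G, ρ g (Quotient.mk E x) = Quotient.mk E y
  iseqv :=
    { refl := fun x => ⟨1, by simp⟩
      symm := by
        rintro x y ⟨g, hg⟩
        exact ⟨g⁻¹, by rw [← hg]; simp⟩
      trans := by
        rintro x y z ⟨g, hg⟩ ⟨h, hh⟩
        exact ⟨h * g, by rw [map_mul, Equiv.Perm.mul_apply, hg, hh]⟩ }

/-- The set of `E`-classes of the points of `Y`. -/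
def classesOf {X : Type*} (E : Setoid X) (Y : Set X) : Set (Quotient E) :=
  Quotient.mk E '' Y

/-- The canonical identification of `Y/E` with the set of `E`-classes of the points of `Y`. -/
noncomputable def quotientRestrictEquiv {X : Type*} (E : Setoid X) (Y : Set X) :
    Quotient (restrictRel E Y) ≃ classesOf E Y :=
  Equiv.ofBijective
    (Quotient.lift
      (fun y : Y => (⟨Quotient.mk E (y : X), (y : X), y.2, rfl⟩ : classesOf E Y))
      (fun _ _ h => Subtype.ext (Quotient.sound h)))
    (by
      constructor
      · intro p q
        induction p using Quotient.inductionOn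
        induction q using Quotient.inductionOn
        intro h
        exact Quotient.sound (show E _ _ from Quotient.exact (congrArg Subtype.val h))
      · rintro ⟨_, y, hy, rfl⟩
        exact ⟨Quotient.mk _ ⟨y, hy⟩, rfl⟩)

theorem quotientRestrictEquiv_mk {X : Type*} (E : Setoid X) (Y : Set X) (y : Y) :
    (quotientRestrictEquiv E Y (Quotient.mk _ y) : Quotient E) = Quotient.mk E (y : X) := rfl

theorem map_mem_classesOf {X G : Type*} [Group G] (E : Setoid X)
    (ρ : G →* Equiv.Perm (Quotient E)) {Y : Set X} (hY : IsInvariantSet (veeRel E ρ) Y) (g : G)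
    {q : Quotient E} (hq : q ∈ classesOf E Y) : ρ g q ∈ classesOf E Y := by
  obtain ⟨y, hy, rfl⟩ := hq
  obtain ⟨z, hz⟩ := Quotient.exists_rep (ρ g (Quotient.mk E y))
  refine ⟨z, ?_, hz⟩
  have h : z ∈ relSaturation (veeRel E ρ) Y :=
    ⟨y, hy, (veeRel E ρ).symm ⟨g, hz.symm⟩⟩
  exact hY ▸ h

/-- For a `G`-invariant set `Y` (that is, an `E^{∨G}`-invariant one), the action of `G` on `Y/E`
obtained by restricting the action of `G` on `X/E`. -/
noncomputable def restrictAction {X G : Type*} [Group G] (E : Setoid X)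
    (ρ : G →* Equiv.Perm (Quotient E)) (Y : Set X) (hY : IsInvariantSet (veeRel E ρ) Y) :
    G →* Equiv.Perm (Quotient (restrictRel E Y)) where
  toFun g := (quotientRestrictEquiv E Y).symm.permCongr
    { toFun := fun q => ⟨ρ g q, map_mem_classesOf E ρ hY g q.2⟩
      invFun := fun q => ⟨ρ g⁻¹ q, map_mem_classesOf E ρ hY g⁻¹ q.2⟩
      left_inv := fun q => Subtype.ext (by simp)
      right_inv := fun q => Subtype.ext (by simp) }
  map_one' := by
    ext q
    simp
  map_mul' g h := by
    ext q
    simp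

/-- The restricted action agrees with the original one under the inclusion `Y/E ⊆ X/E`. -/
theorem restrictAction_apply {X G : Type*} [Group G] (E : Setoid X)
    (ρ : G →* Equiv.Perm (Quotient E)) (Y : Set X) (hY : IsInvariantSet (veeRel E ρ) Y) (g : G)
    (q : Quotient (restrictRel E Y)) :
    (quotientRestrictEquiv E Y (restrictAction E ρ Y hY g q) : Quotient E) =
      ρ g (quotientRestrictEquiv E Y q : Quotient E) := by
  simp [restrictAction]

/-- The action `ρ` of `G` on `X/E` has a class-bijective lift: there is an action `a` of `G` on `X`
by Borel automorphisms of `E` which induces `ρ` and such that `g • x = x` whenever `g • x` and `x`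
are `E`-equivalent (that is, `x ↦ [x]_E` is injective on every `G`-orbit). -/
def HasClassBijectiveLift {X G : Type*} [MeasurableSpace X] [Group G] (E : Setoid X)
    (ρ : G →* Equiv.Perm (Quotient E)) : Prop :=
  ∃ a : G →* borelAut E,
    (∀ (g : G) (x : X), ρ g (Quotient.mk E x) = Quotient.mk E ((a g : Equiv.Perm X) x)) ∧
    ∀ (g : G) (x : X), E ((a g : Equiv.Perm X) x) x → (a g : Equiv.Perm X) x = x

/-! Write F for E^{∨G}. It suffices to find a Borel r that is injective on every E-class and, on a
comeager F-invariant Borel set Y, has fibres that, within an F-class, meet every E-class. Then g·x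
is the unique point of g·[x]_E with the same r-value as x. Uniqueness makes this an action, and
makes g·x = x whenever g·x E x.

Such an r is built from a Borel colouring c : X → ℕ unbounded on every E-class (this is where
aperiodicity enters), a Borel enumeration of F (Lusin–Novikov, `MeasurableSet.graphCoverable`) and a
parameter a : ℕ → ℕ × ℕ. Colours are treated in increasing order; a k tells the points of colour k
which root to try, and an attachment that would put two E-related points in one fibre is refused.
Injectivity on E-classes thus holds for every a. That a fibre meets a prescribed E-class can be
forced for any single point after any finite prefix of a, by using a point of large colour in that
class (`exists_linkRoot_eq_of_prefix`). A Baire category argument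
(`exists_forall_iUnion_mem_residual`) then gives one a that works for comeagerly many points. -/

/-- A set which is covered by countably many Borel graphs of partial functions. -/
def GraphCoverable {X Y : Type*} [MeasurableSpace X] [MeasurableSpace Y] (A : Set (X × Y)) : Prop :=
  ∃ 𝒬 : Set (Set (X × Y)), 𝒬.Countable ∧ (∀ Q ∈ 𝒬, MeasurableSet Q ∧ Set.InjOn Prod.fst Q) ∧ A ⊆ ⋃₀ 𝒬

namespace GraphCoverable

open Set Filter Topology MeasureTheory

variable {X Y : Type*} [MeasurableSpace X] [MeasurableSpace Y] {A B : Set (X × Y)}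

theorem mono (hB : GraphCoverable B) (h : A ⊆ B) : GraphCoverable A := by
  obtain ⟨𝒬, h1, h2, h3⟩ := hB
  exact ⟨𝒬, h1, h2, h.trans h3⟩

theorem biUnion {ι : Type*} {I : Set ι} (hI : I.Countable) {A : ι → Set (X × Y)}
    (h : ∀ i ∈ I, GraphCoverable (A i)) : GraphCoverable (⋃ i ∈ I, A i) := by
  choose! 𝒬 h1 h2 h3 using h
  refine ⟨⋃ i ∈ I, 𝒬 i, hI.biUnion h1, fun Q hQ => ?_, fun p hp => ?_⟩
  · obtain ⟨i, hi, hQ⟩ := mem_iUnion₂.1 hQ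
    exact h2 i hi Q hQ
  · obtain ⟨i, hi, hp⟩ := mem_iUnion₂.1 hp
    obtain ⟨Q, hQ, hpQ⟩ := h3 i hi hp
    exact ⟨Q, mem_iUnion₂.2 ⟨i, hi, hQ⟩, hpQ⟩

theorem union (hA : GraphCoverable A) (hB : GraphCoverable B) : GraphCoverable (A ∪ B) := by
  obtain ⟨𝒬, h1, h2, h3⟩ := hA
  obtain ⟨ℛ, h1', h2', h3'⟩ := hB
  refine ⟨𝒬 ∪ ℛ, h1.union h1', fun Q hQ => hQ.elim (h2 Q) (h2' Q), ?_⟩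
  rw [sUnion_union]
  exact union_subset_union h3 h3'

theorem exists_measurable_superset (hA : GraphCoverable A) :
    ∃ B, A ⊆ B ∧ MeasurableSet B ∧ GraphCoverable B := by
  obtain ⟨𝒬, h1, h2, h3⟩ := hA
  exact ⟨⋃₀ 𝒬, h3, .sUnion h1 fun Q hQ => (h2 Q hQ).1, 𝒬, h1, h2, subset_rfl⟩

end GraphCoverable

/-! ### Lusin–Novikov uniformization -/

section LusinNovikov

open Set Filter Topology MeasureTheory

variable {X Y : Type*} [TopologicalSpace X] [PolishSpace X] [MeasurableSpace X] [BorelSpace X]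
  [TopologicalSpace Y] [PolishSpace Y] [MeasurableSpace Y] [BorelSpace Y]

theorem MeasureTheory.AnalyticSet.inter {Z : Type*} [TopologicalSpace Z] [T2Space Z] {s t : Set Z}
    (hs : AnalyticSet s) (ht : AnalyticSet t) : AnalyticSet (s ∩ t) := by
  rw [inter_eq_iInter]
  exact AnalyticSet.iInter fun b => by cases b <;> assumption

/-- The analytic graph of a partial function is contained in the Borel graph of a partial
function. -/
theorem GraphCoverable.of_analyticSet_of_injOn {A : Set (X × Y)} (hA : AnalyticSet A)
    (hinj : InjOn Prod.fst A) : GraphCoverable A := by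
  have key : ∀ U ∈ TopologicalSpace.countableBasis Y, ∃ B : Set X, MeasurableSet B ∧
      ∀ p ∈ A, p.1 ∈ B ↔ p.2 ∈ U := by
    intro U hU
    have hUm : MeasurableSet (Prod.snd ⁻¹' U : Set (X × Y)) :=
      measurable_snd (TopologicalSpace.isOpen_of_mem_countableBasis hU).measurableSet
    have h1 : AnalyticSet (Prod.fst '' (A ∩ Prod.snd ⁻¹' U)) :=
      (hA.inter hUm.analyticSet).image_of_continuous continuous_fst
    have h2 : AnalyticSet (Prod.fst '' (A ∩ (Prod.snd ⁻¹' U)ᶜ)) :=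
      (hA.inter hUm.compl.analyticSet).image_of_continuous continuous_fst
    obtain ⟨B, hB1, hB2, hBm⟩ := h1.measurablySeparable h2 (by
      rw [Set.disjoint_left]
      rintro _ ⟨p, hp, rfl⟩ ⟨q, hq, hqp⟩
      rw [hinj hq.1 hp.1 hqp] at hq
      exact hq.2 hp.2)
    refine ⟨B, hBm, fun p hp => ⟨fun h => ?_, fun h => hB1 ⟨p, ⟨hp, h⟩, rfl⟩⟩⟩
    by_contra hn
    exact Set.disjoint_left.1 hB2 ⟨p, ⟨hp, hn⟩, rfl⟩ h
  choose! B hBm hB using key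
  -- In this set the first coordinate decides membership of the second in every basic open set,
  -- hence determines it.
  refine ⟨{⋂ U ∈ TopologicalSpace.countableBasis Y, {p : X × Y | p.1 ∈ B U ↔ p.2 ∈ U}},
    countable_singleton _, ?_, ?_⟩
  · rintro _ rfl
    refine ⟨.biInter (TopologicalSpace.countable_countableBasis Y) fun U hU => ?_, ?_⟩
    · have h1 : MeasurableSet {p : X × Y | p.1 ∈ B U} := measurable_fst (hBm U hU)
      have h2 : MeasurableSet {p : X × Y | p.2 ∈ U} :=
        measurable_snd (TopologicalSpace.isOpen_of_mem_countableBasis hU).measurableSet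
      exact h1.iff h2
    · rintro p hp q hq hpq
      refine Prod.ext hpq ?_
      by_contra hne
      obtain ⟨U, hU, hpU, hqU⟩ := (TopologicalSpace.isBasis_countableBasis Y).exists_subset_of_mem_open
        (show p.2 ∈ ({q.2}ᶜ : Set Y) from hne) isOpen_compl_singleton
      have hp' : p.1 ∈ B U ↔ p.2 ∈ U := mem_iInter₂.1 hp U hU
      have hq' : q.1 ∈ B U ↔ q.2 ∈ U := mem_iInter₂.1 hq U hU
      rw [hpq] at hp'
      exact hqU (hq'.1 (hp'.2 hpU)) rfl
  · intro p hp
    exact ⟨_, rfl, mem_iInter₂.2 fun U hU => hB U hU p hp⟩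

/-- The finite family `(P s)_{s ∈ S}` of subsets of `X × Y` is large if, no matter which countable
union of Borel graphs is removed from all of them, some point of `X` lies in the projections of all
of them. -/
def LargeFamily {ι : Type*} (P : ι → Set (X × Y)) (S : Finset ι) : Prop :=
  ∀ Z : Set (X × Y), GraphCoverable Z → ∃ x, ∀ s ∈ S, ∃ y, (x, y) ∈ P s \ Z

/-- If every c failed, a single Borel coverable W would contain all the witnesses. The points of P s
\ W lying over the projections of all P u \ W would then form an analytic partial graph, since two
of them in one section would be split by some c. That graph is coverable, so removing it together
with W contradicts largeness. -/
theorem LargeFamily.exists_split {ι : Type*} [DecidableEq ι] [Countable ι] {P : ι → Set (X × Y)}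
    (hP : ∀ s, AnalyticSet (P s)) {S : Finset ι} (hS : LargeFamily P S) {s : ι} (hs : s ∈ S)
    (C : Set (ι × ι))
    (hC : ∀ p ∈ P s, ∀ q ∈ P s, p.1 = q.1 → p.2 ≠ q.2 → ∃ c ∈ C, p ∈ P c.1 ∧ q ∈ P c.2) :
    ∃ c ∈ C, LargeFamily P (insert c.1 (insert c.2 S)) := by
  by_contra! hcon
  have : ∀ c ∈ C, ∃ Z : Set (X × Y), GraphCoverable Z ∧
      ¬ ∃ x, ∀ s ∈ insert c.1 (insert c.2 S), ∃ y, (x, y) ∈ P s \ Z := by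
    intro c hc
    have := hcon c hc
    unfold LargeFamily at this
    push Not at this
    simpa only [not_exists, not_forall, exists_prop] using this
  choose! Z hZ hZ' using this
  obtain ⟨W, hW, hWm, hWc⟩ :=
    (GraphCoverable.biUnion C.to_countable hZ).exists_measurable_superset
  have hZW : ∀ c ∈ C, Z c ⊆ W := fun c hc => (subset_biUnion_of_mem hc).trans hW
  have hPW : ∀ u, AnalyticSet (P u \ W) := fun u => (hP u).inter hWm.compl.analyticSet
  set A : Set (X × Y) := (P s \ W) ∩ ⋂ u : S, Prod.fst ⁻¹' (Prod.fst '' (P u \ W)) with hA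
  have hmem : ∀ p : X × Y, p ∈ A ↔ p ∈ P s \ W ∧ ∀ u ∈ S, ∃ y, (p.1, y) ∈ P u \ W := by
    intro p
    simp [hA]
  have hAan : AnalyticSet A := by
    have : Nonempty S := ⟨⟨s, hs⟩⟩
    exact (hPW s).inter (AnalyticSet.iInter fun u =>
      ((hPW u).image_of_continuous continuous_fst).preimage continuous_fst)
  have hAinj : InjOn Prod.fst A := by
    intro p hp q hq hpq
    refine Prod.ext hpq ?_
    by_contra hne
    rw [hmem] at hp hq
    obtain ⟨c, hc, h1, h2⟩ := hC p hp.1.1 q hq.1.1 hpq hne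
    refine hZ' c hc ⟨p.1, fun u hu => ?_⟩
    rw [Finset.mem_insert, Finset.mem_insert] at hu
    rcases hu with rfl | rfl | hu
    · exact ⟨p.2, h1, fun h => hp.1.2 (hZW c hc h)⟩
    · exact ⟨q.2, by rw [hpq]; exact h2, fun h => hq.1.2 (hZW c hc (by rw [hpq] at h; exact h))⟩
    · obtain ⟨y, hy⟩ := hp.2 u hu
      exact ⟨y, hy.1, fun h => hy.2 (hZW c hc h)⟩
  obtain ⟨x, hx⟩ := hS _ (hWc.union (.of_analyticSet_of_injOn hAan hAinj))
  obtain ⟨y, hy, hyn⟩ := hx s hs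
  refine hyn (Or.inr ((hmem _).2 ⟨⟨hy, fun h => hyn (Or.inl h)⟩, fun u hu => ?_⟩))
  obtain ⟨z, hz, hzn⟩ := hx u hu
  exact ⟨z, hz, fun h => hzn (Or.inl h)⟩

theorem LargeFamily.exists_split_all {ι : Type*} [DecidableEq ι] [Countable ι]
    {P : ι → Set (X × Y)} (hP : ∀ s, AnalyticSet (P s)) {S : Finset ι} (hS : LargeFamily P S)
    (C : ι → Set (ι × ι))
    (hC : ∀ s, ∀ p ∈ P s, ∀ q ∈ P s, p.1 = q.1 → p.2 ≠ q.2 → ∃ c ∈ C s, p ∈ P c.1 ∧ q ∈ P c.2) :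
    ∃ T, LargeFamily P T ∧ ∀ s ∈ S, ∃ c ∈ C s, c.1 ∈ T ∧ c.2 ∈ T := by
  suffices H : ∀ R ⊆ S, ∃ T, S ⊆ T ∧ LargeFamily P T ∧ ∀ s ∈ R, ∃ c ∈ C s, c.1 ∈ T ∧ c.2 ∈ T by
    obtain ⟨T, -, h⟩ := H S subset_rfl
    exact ⟨T, h⟩
  intro R
  induction R using Finset.induction_on with
  | empty => exact fun _ => ⟨S, subset_rfl, hS, by simp⟩
  | insert a R _ ih =>
    intro hR
    obtain ⟨T, hST, hT, hTC⟩ := ih ((Finset.subset_insert a R).trans hR)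
    obtain ⟨c, hc, hcT⟩ := hT.exists_split hP (hST (hR (Finset.mem_insert_self a R))) (C a) (hC a)
    have hsub : T ⊆ insert c.1 (insert c.2 T) :=
      (Finset.subset_insert _ _).trans (Finset.subset_insert _ _)
    refine ⟨_, hST.trans hsub, hcT, fun s hs => ?_⟩
    rcases Finset.mem_insert.1 hs with rfl | hs
    · exact ⟨c, hc, by simp, by simp⟩
    · obtain ⟨d, hd, h1, h2⟩ := hTC s hs
      exact ⟨d, hd, hsub h1, hsub h2⟩

/-- The basic open subset of Baire space given by a finite sequence, written in reverse as in
`PiNat.res`. -/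
def baireNode (s : List ℕ) : Set (ℕ → ℕ) := {a | PiNat.res a s.length = s}

theorem baireNode_res (a : ℕ → ℕ) (n : ℕ) : baireNode (PiNat.res a n) = PiNat.cylinder a n := by
  rw [PiNat.cylinder_eq_res, baireNode, PiNat.res_length]

theorem eq_of_mem_baireNode {s : List ℕ} {a b : ℕ → ℕ} (ha : a ∈ baireNode s)
    (hb : b ∈ baireNode s) {i : ℕ} (hi : i < s.length) : a i = b i :=
  PiNat.res_eq_res.1 (Eq.trans ha (Eq.symm hb)) hi

theorem baireNode_eq_cylinder {s : List ℕ} {a : ℕ → ℕ} (ha : a ∈ baireNode s) :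
    baireNode s = PiNat.cylinder a s.length := by
  rw [← baireNode_res, show PiNat.res a s.length = s from ha]

theorem isOpen_baireNode (s : List ℕ) : IsOpen (baireNode s) := by
  rcases (baireNode s).eq_empty_or_nonempty with h | ⟨a, ha⟩
  · rw [h]; exact isOpen_empty
  · rw [baireNode_eq_cylinder ha]
    exact PiNat.isOpen_cylinder _ a _

theorem exists_tendsto_of_baireNode_chain {t : ℕ → List ℕ}
    (hsub : ∀ k, baireNode (t (k + 1)) ⊆ baireNode (t k))
    (hlen : ∀ k, (t k).length < (t (k + 1)).length) {b : ℕ → ℕ → ℕ}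
    (hb : ∀ k, b k ∈ baireNode (t k)) :
    ∃ a, (∀ k, a ∈ baireNode (t k)) ∧ Tendsto b atTop (𝓝 a) := by
  have hanti : Antitone fun k => baireNode (t k) := antitone_nat_of_succ_le hsub
  have hle : ∀ k, k ≤ (t k).length := fun k =>
    (strictMono_nat_of_lt_succ (f := fun k => (t k).length) hlen).le_apply
  have hag : ∀ k l i, i < (t k).length → k ≤ l → b l i = b k i := fun k l i hi hkl =>
    eq_of_mem_baireNode (hanti hkl (hb l)) (hb k) hi
  have hlt : ∀ i, i < (t (i + 1)).length := fun i => hle (i + 1)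
  refine ⟨fun i => b (i + 1) i, fun k => ?_, ?_⟩
  · rw [baireNode_eq_cylinder (hb k), PiNat.mem_cylinder_iff]
    intro i hi
    rcases le_total k (i + 1) with h | h
    · exact hag k (i + 1) i hi h
    · exact (hag (i + 1) k i (hlt i) h).symm
  · rw [tendsto_pi_nhds]
    intro i
    refine tendsto_const_nhds.congr' ?_
    filter_upwards [eventually_ge_atTop (i + 1)] with l hl
    exact (hag (i + 1) l i (hlt i) hl).symm

/-- **Lusin–Novikov**: a Borel set with countable vertical sections is covered by countably many
Borel graphs of partial functions. -/
theorem MeasurableSet.graphCoverable {P : Set (X × Y)} (hP : MeasurableSet P)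
    (hcount : ∀ x, {y | (x, y) ∈ P}.Countable) : GraphCoverable P := by
  classical
  by_contra hnc
  have hPan := hP.analyticSet
  rw [AnalyticSet] at hPan
  rcases hPan with rfl | ⟨φ, hφ, hφP⟩
  · exact hnc ⟨∅, countable_empty, by simp, by simp⟩
  let Q : List ℕ → Set (X × Y) := fun s => φ '' baireNode s
  have hQ : ∀ s, AnalyticSet (Q s) := fun s => (isOpen_baireNode s).analyticSet_image hφ
  let C : List ℕ → Set (List ℕ × List ℕ) := fun s => {c |
    (baireNode c.1 ⊆ baireNode s ∧ s.length < c.1.length) ∧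
    (baireNode c.2 ⊆ baireNode s ∧ s.length < c.2.length) ∧
    Disjoint (Prod.snd '' Q c.1) (Prod.snd '' Q c.2)}
  have hC : ∀ s, ∀ p ∈ Q s, ∀ q ∈ Q s, p.1 = q.1 → p.2 ≠ q.2 →
      ∃ c ∈ C s, p ∈ Q c.1 ∧ q ∈ Q c.2 := by
    rintro s _ ⟨a, ha, rfl⟩ _ ⟨b, hb, rfl⟩ - hne
    obtain ⟨U, V, hU, hV, haU, hbV, hUV⟩ := t2_separation hne
    have hcyl : ∀ (a : ℕ → ℕ) (U : Set Y), IsOpen U → (φ a).2 ∈ U →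
        ∃ n, ∀ m, n ≤ m → Prod.snd '' (φ '' PiNat.cylinder a m) ⊆ U := by
      intro a U hU ha
      obtain ⟨_, ⟨a', n, rfl⟩, ha', hs⟩ :=
        (PiNat.isTopologicalBasis_cylinders (fun _ => ℕ)).exists_subset_of_mem_open
          (show a ∈ (fun a => (φ a).2) ⁻¹' U from ha) (hU.preimage hφ.snd)
      refine ⟨n, fun m hm => ?_⟩
      rw [← PiNat.mem_cylinder_iff_eq.1 ha'] at hs
      rintro _ ⟨_, ⟨d, hd, rfl⟩, rfl⟩
      exact hs (PiNat.cylinder_anti a hm hd)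
    obtain ⟨n, hn⟩ := hcyl a U hU haU
    obtain ⟨m, hm⟩ := hcyl b V hV hbV
    let l := max (max n m) (s.length + 1)
    have hl : s.length < l := lt_of_lt_of_le (Nat.lt_succ_self _) (le_max_right _ _)
    refine ⟨(PiNat.res a l, PiNat.res b l), ⟨⟨?_, ?_⟩, ⟨?_, ?_⟩, ?_⟩, ?_, ?_⟩
    · rw [baireNode_res, baireNode_eq_cylinder ha]
      exact PiNat.cylinder_anti a hl.le
    · rwa [PiNat.res_length]
    · rw [baireNode_res, baireNode_eq_cylinder hb]
      exact PiNat.cylinder_anti b hl.le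
    · rwa [PiNat.res_length]
    · simp only [Q, baireNode_res]
      exact hUV.mono (hn l ((le_max_left _ _).trans (le_max_left _ _)))
        (hm l ((le_max_right _ _).trans (le_max_left _ _)))
    · exact ⟨a, by rw [baireNode_res]; exact PiNat.self_mem_cylinder a l, rfl⟩
    · exact ⟨b, by rw [baireNode_res]; exact PiNat.self_mem_cylinder b l, rfl⟩
  have h0 : LargeFamily Q {[]} := by
    intro Z hZ
    have : ¬ P ⊆ Z := fun h => hnc (hZ.mono h)
    obtain ⟨p, hp, hpZ⟩ := not_subset.1 this
    refine ⟨p.1, fun s hs => ⟨p.2, ?_, hpZ⟩⟩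
    rw [Finset.mem_singleton.1 hs]
    rw [← hφP] at hp
    obtain ⟨a, rfl⟩ := hp
    exact ⟨a, rfl, rfl⟩
  choose next hnext hnextC using fun S : {S // LargeFamily Q S} => S.2.exists_split_all hQ C hC
  let S : ℕ → {S // LargeFamily Q S} := fun n => n.rec ⟨{[]}, h0⟩ fun _ S => ⟨next S, hnext S⟩
  have hS : ∀ n, ∀ s ∈ (S n).1, ∃ c ∈ C s, c.1 ∈ (S (n + 1)).1 ∧ c.2 ∈ (S (n + 1)).1 :=
    fun n => hnextC (S n)
  have hx : ∀ n, ∃ x, ∀ s ∈ (S n).1, ∃ b ∈ baireNode s, (φ b).1 = x := by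
    intro n
    obtain ⟨x, hx⟩ := (S n).2 ∅ ⟨∅, countable_empty, by simp, by simp⟩
    refine ⟨x, fun s hs => ?_⟩
    obtain ⟨y, ⟨b, hb, hby⟩, -⟩ := hx s hs
    exact ⟨b, hb, by rw [hby]⟩
  choose x hx using hx
  -- All nodes of level n contain a point over the same x n, so x converges to the first coordinate
  -- of every branch. Two children have disjoint projections to Y, so the branch can dodge y n at
  -- step n.
  have branch : ∀ y : ℕ → Y, ∃ a, Tendsto x atTop (𝓝 (φ a).1) ∧ ∀ n, (φ a).2 ≠ y n := by
    intro y
    have hstep : ∀ n, ∀ s : (S n).1, ∃ t : (S (n + 1)).1, baireNode t.1 ⊆ baireNode s.1 ∧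
        s.1.length < t.1.length ∧ y n ∉ Prod.snd '' Q t.1 := by
      rintro n ⟨s, hs⟩
      obtain ⟨c, ⟨h1, h2, hd⟩, hc1, hc2⟩ := hS n s hs
      by_cases hy : y n ∈ Prod.snd '' Q c.1
      · exact ⟨⟨c.2, hc2⟩, h2.1, h2.2, Set.disjoint_left.1 hd hy⟩
      · exact ⟨⟨c.1, hc1⟩, h1.1, h1.2, hy⟩
    choose T hT1 hT2 hT3 using hstep
    let t : ∀ n, (S n).1 := fun n =>
      n.rec ⟨[], Finset.mem_singleton_self _⟩ fun n s => T n s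
    have ht : ∀ n, t (n + 1) = T n (t n) := fun n => rfl
    choose b hb hbx using fun n => hx n (t n).1 (t n).2
    obtain ⟨a, ha, hlim⟩ := exists_tendsto_of_baireNode_chain (t := fun n => (t n).1)
      (fun k => by rw [ht]; exact hT1 k (t k)) (fun k => by rw [ht]; exact hT2 k (t k)) hb
    refine ⟨a, ?_, fun n hn => ?_⟩
    · have := (hφ.fst.tendsto a).comp hlim
      exact this.congr hbx
    · refine hT3 n (t n) ⟨φ a, ⟨a, ?_, rfl⟩, hn⟩
      rw [← ht]
      exact ha (n + 1)
  have : Nonempty Y := ⟨(φ 0).2⟩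
  obtain ⟨a, ha, -⟩ := branch fun _ => (φ 0).2
  have hmem : ∀ a, φ a ∈ P := fun a => hφP ▸ mem_range_self a
  -- A branch avoiding an enumeration of the section over the common limit still lands in that
  -- section.
  obtain ⟨y, hy⟩ := (hcount (φ a).1).exists_eq_range ⟨(φ a).2, hmem a⟩
  obtain ⟨b, hb, hbn⟩ := branch y
  have : (φ b).2 ∈ {y | ((φ a).1, y) ∈ P} := by
    rw [tendsto_nhds_unique ha hb]
    exact hmem b
  rw [hy] at this
  obtain ⟨n, hn⟩ := this
  exact hbn n hn.symm

/-- A countable Borel equivalence relation is a countable union of graphs of Borel functions. -/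
theorem IsCBER.exists_measurable_enumeration {E : Setoid X} (hE : IsCBER E) :
    ∃ f : ℕ → X → X, (∀ n, Measurable (f n)) ∧ ∀ x y, E x y ↔ ∃ n, f n x = y := by
  classical
  obtain ⟨𝒬, h1, h2, h3⟩ := hE.1.graphCoverable hE.2
  have hne : (insert ∅ 𝒬).Nonempty := insert_nonempty _ _
  obtain ⟨Q, hQ⟩ := (h1.insert ∅).exists_eq_range hne
  have hQ' : ∀ n, MeasurableSet (Q n) ∧ InjOn Prod.fst (Q n) := by
    intro n
    rcases (hQ ▸ mem_range_self n : Q n ∈ insert ∅ 𝒬) with h | h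
    · rw [h]; simp
    · exact h2 _ h
  let R : ℕ → Set (X × X) := fun n => Q n ∩ {p | E p.1 p.2}
  have hRm : ∀ n, MeasurableSet (R n) := fun n => (hQ' n).1.inter hE.1
  have hRi : ∀ n, InjOn Prod.fst (R n) := fun n => (hQ' n).2.mono inter_subset_left
  -- The default value x keeps f n total with its graph inside E.
  let f : ℕ → X → X := fun n x => if h : ∃ y, (x, y) ∈ R n then h.choose else x
  have hf : ∀ n x y, (x, y) ∈ R n → f n x = y := by
    intro n x y h
    have hex : ∃ y, (x, y) ∈ R n := ⟨y, h⟩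
    simp only [f, dif_pos hex]
    exact congrArg Prod.snd (hRi n hex.choose_spec h rfl)
  refine ⟨f, fun n => ?_, fun x y => ⟨fun h => ?_, ?_⟩⟩
  · intro B hB
    have : f n ⁻¹' B = Prod.fst '' (R n ∩ Prod.snd ⁻¹' B) ∪ ((Prod.fst '' R n)ᶜ ∩ B) := by
      ext x
      by_cases hex : ∃ y, (x, y) ∈ R n
      · obtain ⟨y, hy⟩ := hex
        have h' : ∀ z, (x, z) ∈ R n ↔ z = y := fun z =>
          ⟨fun hz => (hf n x z hz).symm.trans (hf n x y hy), fun h => h ▸ hy⟩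
        simp [hf n x y hy, h']
      · have : f n x = x := dif_neg hex
        push Not at hex
        simp [this, hex]
    rw [this]
    exact (((hRm n).inter (measurable_snd hB)).image_of_measurable_injOn measurable_fst
      ((hRi n).mono inter_subset_left)).union
      (((hRm n).image_of_measurable_injOn measurable_fst (hRi n)).compl.inter hB)
  · obtain ⟨q, hq, hxy⟩ := h3 (show (x, y) ∈ {p : X × X | E p.1 p.2} from h)
    obtain ⟨n, rfl⟩ := (hQ ▸ mem_insert_of_mem _ hq : q ∈ range Q)
    exact ⟨n, hf n x y ⟨hxy, h⟩⟩
  · rintro ⟨n, rfl⟩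
    by_cases hex : ∃ y, (x, y) ∈ R n
    · obtain ⟨y, hy⟩ := hex
      rw [hf n x y hy]
      exact hy.2
    · rw [show f n x = x from dif_neg hex]

end LusinNovikov

/-! ### A colouring unbounded on every class -/

section Marker

open Set Filter Topology MeasureTheory

variable {X : Type*} [TopologicalSpace X] [PolishSpace X] [MeasurableSpace X] [BorelSpace X]

theorem IsCBER.measurableSet_infinite {E : Setoid X} (hE : IsCBER E) {P : Set X}
    (hP : MeasurableSet P) : MeasurableSet {x | {y | E x y ∧ y ∈ P}.Infinite} := by
  classical
  obtain ⟨f, hf, hfE⟩ := hE.exists_measurable_enumeration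
  have : {x | {y | E x y ∧ y ∈ P}.Infinite} =
      -- Infinite means that beyond any first m enumerated points there is a new one in P.
      ⋂ m : ℕ, ⋃ n : ℕ, (f n ⁻¹' P ∩ ⋂ i ∈ Finset.range m, {x | f i x = f n x}ᶜ) := by
    ext x
    simp only [mem_ofPred_eq, mem_iInter, mem_iUnion, mem_inter_iff, mem_preimage, mem_compl_iff,
      Finset.mem_range]
    constructor
    · intro h m
      obtain ⟨y, ⟨hxy, hyP⟩, hy⟩ := h.exists_notMem_finset
        ((Finset.range m).image (f · x))
      obtain ⟨n, rfl⟩ := (hfE x y).1 hxy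
      exact ⟨n, hyP, fun i hi hin => hy (Finset.mem_image.2 ⟨i, Finset.mem_range.2 hi, hin⟩)⟩
    · intro h hfin
      have hidx : ∀ y, ∃ n, E x y → f n x = y := fun y => by
        by_cases hxy : E x y
        · obtain ⟨n, hn⟩ := (hfE x y).1 hxy
          exact ⟨n, fun _ => hn⟩
        · exact ⟨0, fun h => absurd h hxy⟩
      choose g hg using hidx
      obtain ⟨m, hm⟩ := (hfin.image g).bddAbove
      obtain ⟨n, hn, hni⟩ := h (m + 1)
      have hxn : E x (f n x) := (hfE _ _).2 ⟨n, rfl⟩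
      exact hni (g (f n x)) (Nat.lt_succ_of_le (hm ⟨f n x, ⟨hxn, hn⟩, rfl⟩)) (hg _ hxn)
  rw [this]
  exact .iInter fun m => .iUnion fun n => (hf n hP).inter
    (.biInter (Finset.countable_toSet _) fun i _ => (measurableSet_eq_fun (hf i) (hf n)).compl)

/-- An aperiodic countable Borel equivalence relation admits a Borel function to `ℕ` which is
unbounded on every class. -/
theorem IsCBER.exists_measurable_unbounded {E : Setoid X} (hE : IsCBER E)
    (hap : IsAperiodicRel E) :
    ∃ c : X → ℕ, Measurable c ∧ ∀ x n, ∃ y, E x y ∧ n ≤ c y := by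
  let u : X → ℝ := fun x => Real.arctan (embeddingReal X x)
  have hu : Measurable u := Real.measurable_arctan.comp (measurable_embeddingReal X)
  have huinj : Function.Injective u :=
    Real.arctan_injective.comp (measurableEmbedding_embeddingReal X).injective
  let S : X → Set ℝ := fun x => {q | {y | E x y ∧ q < u y}.Infinite}
  have hSanti : ∀ x q q', q ≤ q' → q' ∈ S x → q ∈ S x := fun x q q' hq h =>
    Set.Infinite.mono (fun y hy => ⟨hy.1, hq.trans_lt hy.2⟩) h
  have hSne : ∀ x, (S x).Nonempty := fun x => ⟨-(Real.pi / 2),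
    Set.Infinite.mono (fun y hy => ⟨hy, Real.neg_pi_div_two_lt_arctan _⟩) (hap x)⟩
  have hSbdd : ∀ x, BddAbove (S x) := fun x => ⟨Real.pi / 2, fun q hq => by
    obtain ⟨y, -, hy⟩ := Set.Infinite.nonempty hq
    exact (hy.trans (Real.arctan_lt_pi_div_two _)).le⟩
  let p : X → ℝ := fun x => sSup (S x)
  have hpE : ∀ x y, E x y → p y = p x := by
    intro x y hxy
    have : ∀ z, E y z ↔ E x z := fun z => ⟨E.trans hxy, E.trans (E.symm hxy)⟩
    simp only [p, S, this]
  have hp : Measurable p := by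
    refine measurable_of_Ioi fun t => ?_
    have : p ⁻¹' Ioi t = ⋃ q : ℚ, {x | t < q ∧ (q : ℝ) ∈ S x} := by
      ext x
      simp only [mem_preimage, mem_Ioi, mem_iUnion, mem_ofPred_eq]
      constructor
      · intro h
        obtain ⟨s, hs, hts⟩ := exists_lt_of_lt_csSup (hSne x) h
        obtain ⟨q, hq1, hq2⟩ := exists_rat_btwn hts
        exact ⟨q, hq1, hSanti x _ _ hq2.le hs⟩
      · rintro ⟨q, hq, hqS⟩
        exact hq.trans_le (le_csSup (hSbdd x) hqS)
    rw [this]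
    refine .iUnion fun q => (MeasurableSet.const _).inter ?_
    exact hE.measurableSet_infinite (P := {y | (q : ℝ) < u y}) (measurableSet_lt measurable_const hu)
  -- p is the upper limit of the bounded injection u along the class, so every class has infinitely
  -- many points with u arbitrarily close to p. The one possible point with u = p gets colour 0 by
  -- 0⁻¹ = 0 and is discarded below.
  refine ⟨fun x => ⌊|u x - p x|⁻¹⌋₊,
    Nat.measurable_floor.comp (continuous_abs.measurable.comp (hu.sub hp)).inv, fun x n => ?_⟩
  have hε : (0 : ℝ) < 1 / (n + 1) := by positivity
  set ε : ℝ := 1 / (n + 1) with hεn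
  have h1 : p x - ε ∈ S x := by
    obtain ⟨s, hs, hts⟩ := exists_lt_of_lt_csSup (hSne x) (sub_lt_self (p x) hε)
    exact hSanti x _ _ hts.le hs
  have h2 : p x + ε ∉ S x := fun h => absurd (le_csSup (hSbdd x) h) (not_le.2 (by linarith))
  have h3 : {y | E x y ∧ p x + ε < u y}.Finite := not_infinite.1 h2
  have h4 : {y | u y = p x}.Finite :=
    Set.Subsingleton.finite fun y hy z hz => huinj (Eq.trans hy (Eq.symm hz))
  obtain ⟨y, ⟨hy1, hy2⟩, hy3⟩ := (Set.Infinite.sdiff h1 (h3.union h4)).nonempty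
  simp only [mem_union, mem_ofPred_eq, not_or, not_and, not_lt] at hy2 hy3
  refine ⟨y, hy1, Nat.le_floor ?_⟩
  rw [hpE x y hy1]
  have hle : |u y - p x| ≤ ε := abs_le.2 ⟨by linarith, by linarith [hy3.1 hy1]⟩
  have hpos : 0 < |u y - p x| := abs_pos.2 (sub_ne_zero.2 hy3.2)
  calc (n : ℝ) ≤ ε⁻¹ := by rw [hεn]; simp
    _ ≤ _ := inv_anti₀ hpos hle

end Marker

/-! ### Choosing a generic parameter -/

section Generic

open Set Filter Topology MeasureTheory

/-- A Kuratowski–Ulam type principle. The sets `⋃ m, S j a m` depend on a parameter `a : ℕ → ι` in an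
open way; if each point `x` lies in them for a dense set of parameters, then for some parameter they
are all comeager. -/
theorem exists_forall_iUnion_mem_residual {X ι κ : Type*} [TopologicalSpace X] [BaireSpace X]
    [SecondCountableTopology X] [Countable ι] [Nonempty ι] [Countable κ]
    (S : κ → (ℕ → ι) → ℕ → Set X) (hS : ∀ j a m, BaireMeasurableSet (S j a m))
    (hloc : ∀ j (a b : ℕ → ι) m, (∀ i < m, a i = b i) → S j a m = S j b m)
    (hdense : ∀ j (a : ℕ → ι) n x, ∃ b : ℕ → ι, (∀ i < n, b i = a i) ∧ ∃ m, x ∈ S j b m) :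
    ∃ a, ∀ j, ⋃ m, S j a m ∈ residual X := by
  let : TopologicalSpace ι := ⊥
  have : DiscreteTopology ι := ⟨rfl⟩
  choose! U hUo hU using fun (s : Set X) (hs : BaireMeasurableSet s) => hs.residualEq_isOpen
  let O : κ × TopologicalSpace.countableBasis X → Set (ℕ → ι) := fun q =>
    {a | ∃ m, (U (S q.1 a m) ∩ q.2).Nonempty}
  have hOo : ∀ q, IsOpen (O q) := by
    intro q
    refine isOpen_iff_mem_nhds.2 fun a ha => ?_
    obtain ⟨m, hm⟩ := ha
    refine mem_of_superset ((PiNat.isOpen_cylinder _ a m).mem_nhds (PiNat.self_mem_cylinder a m)) ?_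
    intro b hb
    exact ⟨m, by rw [hloc q.1 b a m hb]; exact hm⟩
  have hOd : ∀ q, Dense (O q) := by
    rintro ⟨j, V, hV⟩
    rw [(PiNat.isTopologicalBasis_cylinders (fun _ : ℕ => ι)).dense_iff]
    rintro _ ⟨a, n, rfl⟩ -
    by_contra hcon
    rw [not_nonempty_iff_eq_empty, ← Set.disjoint_iff_inter_eq_empty] at hcon
    -- The open approximations are valid at a generic x only for countably many parameters at once.
    -- Locality allows a parameter from `hdense` to be replaced by one in Q with the same long
    -- prefix.
    obtain ⟨Q, hQc, hQd⟩ := TopologicalSpace.exists_countable_dense (ℕ → ι)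
    have hres : ∀ᶠ x in residual X, ∀ b ∈ Q, ∀ m, x ∈ S j b m ↔ x ∈ U (S j b m) :=
      (eventually_countable_ball hQc).2 fun b _ => eventually_countable_forall.2 fun m =>
        (hU _ (hS j b m)).mem_iff
    obtain ⟨x, hxV, hx⟩ := (dense_of_mem_residual hres).inter_open_nonempty V
      (TopologicalSpace.isOpen_of_mem_countableBasis hV)
      (TopologicalSpace.nonempty_of_mem_countableBasis hV)
    obtain ⟨b, hb, m, hxb⟩ := hdense j a n x
    obtain ⟨b', hb', hbQ⟩ := hQd.inter_open_nonempty _ (PiNat.isOpen_cylinder _ b (max m n))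
      ⟨b, PiNat.self_mem_cylinder b _⟩
    refine Set.disjoint_left.1 hcon (show b' ∈ PiNat.cylinder a n from fun i hi => ?_) ⟨m, x, ?_, hxV⟩
    · exact (hb' i (lt_max_of_lt_right hi)).trans (hb i hi)
    · rw [← hx b' hbQ m, hloc j b' b m fun i hi => hb' i (lt_max_of_lt_left hi)]
      exact hxb
  obtain ⟨a, ha⟩ := (dense_iInter_of_isOpen hOo hOd).nonempty
  refine ⟨a, fun j => ?_⟩
  have hdns : Dense (⋃ m, U (S j a m)) := by
    rw [(TopologicalSpace.isBasis_countableBasis X).dense_iff]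
    intro V hV _
    obtain ⟨m, x, hxU, hxV⟩ := mem_iInter.1 ha (j, ⟨V, hV⟩)
    exact ⟨x, hxV, mem_iUnion.2 ⟨m, hxU⟩⟩
  have hres : ∀ᶠ x in residual X, ∀ m, x ∈ S j a m ↔ x ∈ U (S j a m) :=
    eventually_countable_forall.2 fun m => (hU _ (hS j a m)).mem_iff
  filter_upwards [hres, residual_of_dense_open (isOpen_iUnion fun m => hUo _ (hS j a m)) hdns]
    with x hx hxU
  obtain ⟨m, hm⟩ := mem_iUnion.1 hxU
  exact mem_iUnion.2 ⟨m, (hx m).2 hm⟩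

end Generic

/-! ### Construction of the root function -/

section Link

open Set Filter Topology MeasureTheory

variable {X : Type*}

/-- The point `y` can be attached to the root `x = f p.2 y` of the root function `r`: `x` has smaller
colour than `y`, `y` is `f p.1 x`, and no point of smaller colour attached to `x` is `E`-related to
`y`. -/
def Attachable (E : Setoid X) (f : ℕ → X → X) (c : X → ℕ) (r : X → X) (p : ℕ × ℕ) (y : X) : Prop :=
  f p.1 (f p.2 y) = y ∧ c (f p.2 y) < c y ∧ r (f p.2 y) = f p.2 y ∧
    ∀ l, c (f l (f p.2 y)) < c y → r (f l (f p.2 y)) = f p.2 y → ¬ E (f l (f p.2 y)) y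

open Classical in
/-- Stage `k` of the construction of the root function of a link: the points of colour less than `k`
have been assigned a root and all other points are their own roots. At stage `k` the points of colour
`k` are attached to the root with index `a k` when possible. -/
noncomputable def rootStage (E : Setoid X) (f : ℕ → X → X) (c : X → ℕ) (a : ℕ → ℕ × ℕ) :
    ℕ → X → X
  | 0, y => y
  | k + 1, y => if c y = k ∧ Attachable E f c (rootStage E f c a k) (a k) y then f (a k).2 y
    else rootStage E f c a k y

/-- The final root function. -/
noncomputable def linkRoot (E : Setoid X) (f : ℕ → X → X) (c : X → ℕ) (a : ℕ → ℕ × ℕ) (y : X) : X :=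
  rootStage E f c a (c y + 1) y

variable {E F : Setoid X} {f : ℕ → X → X} {c : X → ℕ} {a b : ℕ → ℕ × ℕ}

theorem rootStage_of_le {k : ℕ} {y : X} (h : k ≤ c y) : rootStage E f c a k y = y := by
  induction k with
  | zero => rfl
  | succ k ih =>
    rw [rootStage, if_neg fun h' => by omega]
    exact ih (by omega)

theorem rootStage_of_lt {k : ℕ} {y : X} (h : c y < k) :
    rootStage E f c a k y = linkRoot E f c a y := by
  induction k with
  | zero => omega
  | succ k ih =>
    rcases Nat.lt_succ_iff_lt_or_eq.1 h with h' | h'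
    · rw [rootStage, if_neg fun h'' => by omega]
      exact ih h'
    · rw [← h', linkRoot]

theorem rootStage_congr {k : ℕ} (h : ∀ i < k, a i = b i) :
    rootStage E f c a k = rootStage E f c b k := by
  induction k with
  | zero => rfl
  | succ k ih =>
    funext y
    rw [rootStage, rootStage, ih fun i hi => h i (by omega), h k (by omega)]

theorem linkRoot_congr {k : ℕ} (h : ∀ i < k, a i = b i) {y : X} (hy : c y < k) :
    linkRoot E f c a y = linkRoot E f c b y := by
  rw [linkRoot, linkRoot, rootStage_congr fun i hi => h i (by omega)]

/-- Attachability of y consults roots only at points of colour below c y, and these are final by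
stage c y. -/
theorem attachable_rootStage_iff {p : ℕ × ℕ} {y : X} :
    Attachable E f c (rootStage E f c a (c y)) p y ↔ Attachable E f c (linkRoot E f c a) p y := by
  refine and_congr_right fun _ => and_congr_right fun h => ?_
  rw [rootStage_of_lt h]
  refine and_congr_right fun _ => forall_congr' fun l => imp_congr_right fun hl => ?_
  rw [rootStage_of_lt hl]

theorem linkRoot_spec (y : X) : linkRoot E f c a y = y ∨
    linkRoot E f c a y = f (a (c y)).2 y ∧ Attachable E f c (linkRoot E f c a) (a (c y)) y := by
  by_cases h : Attachable E f c (linkRoot E f c a) (a (c y)) y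
  · exact Or.inr ⟨by rw [linkRoot, rootStage, if_pos ⟨rfl, attachable_rootStage_iff.2 h⟩], h⟩
  · refine Or.inl ?_
    rw [linkRoot, rootStage, if_neg fun h' => h (attachable_rootStage_iff.1 h'.2)]
    exact rootStage_of_le le_rfl

theorem Attachable.linkRoot_eq {y : X} (h : Attachable E f c (linkRoot E f c a) (a (c y)) y) :
    linkRoot E f c a y = f (a (c y)).2 y := by
  rw [linkRoot, rootStage, if_pos ⟨rfl, attachable_rootStage_iff.2 h⟩]

theorem linkRoot_linkRoot (y : X) :
    linkRoot E f c a (linkRoot E f c a y) = linkRoot E f c a y := by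
  rcases linkRoot_spec (E := E) (f := f) (c := c) (a := a) y with h | ⟨h, h'⟩
  · rw [h, h]
  · rw [h]
    exact h'.2.2.1

theorem color_linkRoot_le (y : X) : c (linkRoot E f c a y) ≤ c y := by
  rcases linkRoot_spec (E := E) (f := f) (c := c) (a := a) y with h | ⟨h, h'⟩
  · rw [h]
  · rw [h]
    exact h'.2.1.le

theorem rel_linkRoot (hf : ∀ x y, F x y ↔ ∃ n, f n x = y) (y : X) :
    F y (linkRoot E f c a y) := by
  rcases linkRoot_spec (E := E) (f := f) (c := c) (a := a) y with h | ⟨h, -⟩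
  · rw [h]
  · exact (hf _ _).2 ⟨_, h.symm⟩

/-- Distinct `E`-related points have distinct roots. -/
theorem eq_of_linkRoot_eq (hf : ∀ x y, F x y ↔ ∃ n, f n x = y) {y z : X} (hyz : E y z)
    (h : linkRoot E f c a y = linkRoot E f c a z) : y = z := by
  wlog hle : c y ≤ c z generalizing y z
  · exact (this (E.symm hyz) h.symm (by omega)).symm
  -- If z is its own root, y must be too: otherwise its root z would have colour less than c y ≤ c
  -- z.
  rcases linkRoot_spec (E := E) (f := f) (c := c) (a := a) z with hz | ⟨hz, hz1, hz2, -, hz3⟩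
  · rcases linkRoot_spec (E := E) (f := f) (c := c) (a := a) y with hy | ⟨hy, -, hy2, -⟩
    · rw [← hy, h, hz]
    · rw [← hy, h, hz] at hy2
      omega
  · rcases hle.lt_or_eq with hlt | heq
    -- Here y is an earlier point of the same fibre, so the last clause of `Attachable` forbade
    -- attaching z.
    · obtain ⟨l, hl⟩ := (hf _ _).1 (F.symm (rel_linkRoot (E := E) (c := c) (a := a) hf y))
      rw [h, hz] at hl
      refine absurd hyz ?_
      have := hz3 l
      rw [hl] at this
      exact this hlt (h.trans hz)
    -- Points of equal colour use the same pair, whose first index recovers each of them from the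
    -- common root.
    · rcases linkRoot_spec (E := E) (f := f) (c := c) (a := a) y with hy | ⟨hy, hy1, -⟩
      · rw [← hz, ← h, hy] at hz2
        omega
      · rw [← hy1, ← hz1, ← hy, ← hz, heq, h]

/-- A point z of [y]_E with large colour is still free: unless the fibre of x already meets that
class below colour c z, redirecting a at c z alone attaches z to the root of x. -/
theorem exists_linkRoot_eq_of_prefix (hEF : ∀ x y, E x y → F x y)
    (hf : ∀ x y, F x y ↔ ∃ n, f n x = y) (hc : ∀ x n, ∃ y, E x y ∧ n ≤ c y) {x y : X}
    (hxy : F x y) (a : ℕ → ℕ × ℕ) (n : ℕ) :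
    ∃ b, (∀ i < n, b i = a i) ∧ ∃ z, E z y ∧ linkRoot E f c b z = linkRoot E f c b x := by
  -- Colour at least n preserves the prefix; colour above c x preserves the root of x.
  obtain ⟨z, hyz, hz⟩ := hc y (max n (c x + 1))
  have hxz : c x < c z := by omega
  set r := linkRoot E f c a x with hr
  have hrz : F r z := F.trans (F.symm (rel_linkRoot hf x)) (F.trans hxy (hEF _ _ hyz))
  have hrc : c r < c z := (color_linkRoot_le x).trans_lt hxz
  by_cases hex : ∃ l, c (f l r) < c z ∧ linkRoot E f c a (f l r) = r ∧ E (f l r) z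
  · obtain ⟨l, -, h1, h2⟩ := hex
    exact ⟨a, fun _ _ => rfl, f l r, E.trans h2 (E.symm hyz), h1⟩
  push Not at hex
  obtain ⟨i, hi⟩ := (hf _ _).1 hrz
  obtain ⟨j, hj⟩ := (hf _ _).1 (F.symm hrz)
  have hagree : ∀ k < c z, Function.update a (c z) (i, j) k = a k := fun k hk =>
    Function.update_of_ne hk.ne _ _
  refine ⟨Function.update a (c z) (i, j), fun k hk => hagree k (by omega), z, E.symm hyz, ?_⟩
  rw [linkRoot_congr hagree hxz, ← hr]
  refine (Attachable.linkRoot_eq ?_).trans (by simpa using hj)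
  rw [Function.update_self]
  refine ⟨by rw [hj, hi], by rwa [hj], ?_, fun l hl h => ?_⟩
  · rw [hj, linkRoot_congr hagree hrc]
    exact linkRoot_linkRoot x
  · rw [linkRoot_congr hagree hl] at h
    simp only [hj] at hl h ⊢
    exact hex l hl h

section Measurability

variable [TopologicalSpace X] [PolishSpace X] [MeasurableSpace X] [BorelSpace X]

theorem measurableSet_attachable (hE : IsCBER E) (hf : ∀ n, Measurable (f n)) (hc : Measurable c)
    {r : X → X} (hr : Measurable r) (p : ℕ × ℕ) : MeasurableSet {y | Attachable E f c r p y} := by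
  have hj := hf p.2
  refine (measurableSet_eq_fun ((hf _).comp hj) measurable_id).inter
    ((measurableSet_lt (hc.comp hj) hc).inter
    ((measurableSet_eq_fun (hr.comp hj) hj).inter ?_))
  refine measurableSet_setOfPred.2 (Measurable.forall fun l => measurableSet_setOfPred.1 ?_)
  have hl := (hf l).comp hj
  exact (measurableSet_lt (hc.comp hl) hc).imp
    ((measurableSet_eq_fun (hr.comp hl) hj).imp (hl.prodMk measurable_id hE.1).compl)

theorem measurable_rootStage (hE : IsCBER E) (hf : ∀ n, Measurable (f n)) (hc : Measurable c)
    (k : ℕ) : Measurable (rootStage E f c a k) := by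
  induction k with
  | zero => exact measurable_id
  | succ k ih =>
    exact Measurable.ite ((measurableSet_eq_fun hc measurable_const).inter
      (measurableSet_attachable hE hf hc ih _)) (hf _) ih

theorem measurable_linkRoot (hE : IsCBER E) (hf : ∀ n, Measurable (f n)) (hc : Measurable c) :
    Measurable (linkRoot E f c a) := by
  intro B hB
  have : linkRoot E f c a ⁻¹' B = ⋃ k, ({y | c y = k} ∩ rootStage E f c a (k + 1) ⁻¹' B) := by
    ext y
    simp [linkRoot]
  rw [this]
  exact .iUnion fun k => (measurableSet_eq_fun hc measurable_const).inter
    (measurable_rootStage hE hf hc _ hB)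

/-- Generically, an aperiodic countable Borel equivalence relation `E` contained in `F` has a
complement: the kernel of a Borel function `r` each of whose fibres, in a given `F`-class, meets
every `E`-class in exactly one point. -/
theorem exists_generic_link (hE : IsCBER E) (hap : IsAperiodicRel E) (hF : IsCBER F)
    (hEF : ∀ x y, E x y → F x y) :
    ∃ r : X → X, Measurable r ∧ (∀ y z, E y z → r y = r z → y = z) ∧
      {x | ∀ y z, F x y → F x z → ∃ w, E w z ∧ r w = r y} ∈ residual X ∧
      MeasurableSet {x | ∀ y z, F x y → F x z → ∃ w, E w z ∧ r w = r y} := by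
  obtain ⟨f, hfm, hf⟩ := hF.exists_measurable_enumeration
  obtain ⟨c, hcm, hc⟩ := hE.exists_measurable_unbounded hap
  have hfF : ∀ n x, F x (f n x) := fun n x => (hf _ _).2 ⟨n, rfl⟩
  -- The colour bounds make S q a k depend only on the first k values of a, as locality requires.
  let S : ℕ × ℕ → (ℕ → ℕ × ℕ) → ℕ → Set X := fun q a k => ⋃ l, {x | c (f l x) < k ∧
    c (f q.1 x) < k ∧ E (f l x) (f q.2 x) ∧ linkRoot E f c a (f l x) = linkRoot E f c a (f q.1 x)}
  have hSm : ∀ q a k, MeasurableSet (S q a k) := fun q a k => .iUnion fun l =>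
    (measurableSet_lt (hcm.comp (hfm l)) measurable_const).inter
    ((measurableSet_lt (hcm.comp (hfm _)) measurable_const).inter
    (((hfm l).prodMk (hfm _) hE.1).inter
    (measurableSet_eq_fun ((measurable_linkRoot hE hfm hcm).comp (hfm l))
      ((measurable_linkRoot hE hfm hcm).comp (hfm _)))))
  obtain ⟨a, ha⟩ := exists_forall_iUnion_mem_residual S (fun q a k => (hSm q a k).baireMeasurableSet)
    (by
      intro q a b k hab
      ext x
      simp only [S, mem_iUnion, mem_ofPred_eq]
      refine exists_congr fun l => and_congr_right fun h1 => and_congr_right fun h2 => ?_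
      rw [linkRoot_congr hab h1, linkRoot_congr hab h2])
    (by
      rintro ⟨m, n⟩ a N x
      obtain ⟨b, hb, z, hz, hzr⟩ := exists_linkRoot_eq_of_prefix (x := f m x) (y := f n x) hEF hf hc
        (F.trans (F.symm (hfF m x)) (hfF n x)) a N
      obtain ⟨l, rfl⟩ := (hf x z).1 (F.trans (hfF n x) (hEF _ _ (E.symm hz)))
      exact ⟨b, hb, max (c (f l x)) (c (f m x)) + 1,
        mem_iUnion.2 ⟨l, by omega, by simp only; omega, hz, hzr⟩⟩)
  have heq : {x | ∀ y z, F x y → F x z → ∃ w, E w z ∧ linkRoot E f c a w = linkRoot E f c a y} =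
      ⋂ q : ℕ × ℕ, ⋃ k, S q a k := by
    ext x
    simp only [mem_ofPred_eq, mem_iInter, mem_iUnion, S, Prod.forall]
    constructor
    · intro h m n
      obtain ⟨w, hw, hwr⟩ := h _ _ (hfF m x) (hfF n x)
      obtain ⟨l, rfl⟩ := (hf x w).1 (F.trans (hfF n x) (hEF _ _ (E.symm hw)))
      exact ⟨max (c (f l x)) (c (f m x)) + 1, l, by omega, by omega, hw, hwr⟩
    · intro h y z hy hz
      obtain ⟨m, rfl⟩ := (hf _ _).1 hy
      obtain ⟨n, rfl⟩ := (hf _ _).1 hz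
      obtain ⟨-, l, -, -, h1, h2⟩ := h m n
      exact ⟨_, h1, h2⟩
  refine ⟨linkRoot E f c a, measurable_linkRoot hE hfm hcm, fun y z => eq_of_linkRoot_eq hf, ?_, ?_⟩
  · rw [heq]
    exact countable_iInter_mem.2 ha
  · rw [heq]
    exact .iInter fun q => .iUnion fun k => hSm q a k

end Measurability

end Link

theorem veeRel_of_rel {X G : Type*} [Group G] {E : Setoid X} {ρ : G →* Equiv.Perm (Quotient E)}
    {x y : X} (h : E x y) : veeRel E ρ x y :=
  ⟨1, by simpa using Quotient.sound h⟩

/-! ### From the root function to the lift -/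

section Lift

open Set Filter Topology MeasureTheory

variable {X G : Type*} [MeasurableSpace X] [Group G] {E : Setoid X}
  {ρ : G →* Equiv.Perm (Quotient E)}

theorem isCBER_veeRel [Countable G] (hE : IsCBER E) (hρ : IsBorelQuotientAction E ρ) :
    IsCBER (veeRel E ρ) := by
  constructor
  · have : {p : X × X | veeRel E ρ p.1 p.2} =
        ⋃ g, {p : X × X | ρ g (Quotient.mk E p.1) = Quotient.mk E p.2} := by
      ext p
      simp only [mem_iUnion, mem_ofPred_eq]
      rfl
    rw [this]
    exact .iUnion hρ
  · intro x
    have : {y | veeRel E ρ x y} ⊆ ⋃ g, {y | E (ρ g (Quotient.mk E x)).out y} := by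
      rintro y ⟨g, hg⟩
      refine mem_iUnion.2 ⟨g, ?_⟩
      rw [hg]
      exact Quotient.exact (Quotient.out_eq _)
    exact (countable_iUnion fun g => hE.2 _).mono this

/-- A Borel function `r` whose fibres, within the `E^{∨G}`-classes contained in the invariant Borel
set `Y`, meet every `E`-class in exactly one point, induces a class-bijective lift on `Y`. -/
theorem hasClassBijectiveLift_of_link [MeasurableEq X]
    (hρ : IsBorelQuotientAction E ρ)
    {f : ℕ → X → X} (hfm : ∀ n, Measurable (f n)) (hf : ∀ x y, veeRel E ρ x y ↔ ∃ n, f n x = y)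
    {r : X → X} (hr : Measurable r) (hinj : ∀ y z, E y z → r y = r z → y = z) {Y : Set X}
    (hY : IsInvariantSet (veeRel E ρ) Y)
    (hex : ∀ x ∈ Y, ∀ z, veeRel E ρ x z → ∃ w, E w z ∧ r w = r x) :
    HasClassBijectiveLift (restrictRel E Y) (restrictAction E ρ Y hY) := by
  have hYinv : ∀ x y, veeRel E ρ x y → x ∈ Y → y ∈ Y := fun x y hxy hx => by
    rw [hY]
    exact ⟨x, hx, (veeRel E ρ).symm hxy⟩
  have hT : ∀ (g : G) (x : Y), ∃ w : Y, ρ g (Quotient.mk E (x : X)) = Quotient.mk E (w : X) ∧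
      r w = r x := by
    rintro g ⟨x, hx⟩
    obtain ⟨z, hz⟩ := Quotient.exists_rep (ρ g (Quotient.mk E x))
    obtain ⟨w, hwz, hwr⟩ := hex x hx z ⟨g, hz.symm⟩
    have hw : ρ g (Quotient.mk E x) = Quotient.mk E w := by
      rw [← hz]
      exact Quotient.sound (E.symm hwz)
    exact ⟨⟨w, hYinv x w ⟨g, hw⟩ hx⟩, hw, hwr⟩
  choose T hTρ hTr using hT
  have huniq : ∀ (g : G) (x w : Y), ρ g (Quotient.mk E (x : X)) = Quotient.mk E (w : X) →
      r w = r x → T g x = w := fun g x w h1 h2 => Subtype.ext <|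
    hinj _ _ (Quotient.exact ((hTρ g x).symm.trans h1)) ((hTr g x).trans h2.symm)
  have hone : ∀ x, T 1 x = x := fun x => huniq 1 x x (by simp) rfl
  have hmul : ∀ g h x, T (g * h) x = T g (T h x) := fun g h x => huniq _ _ _
    (by rw [map_mul, Equiv.Perm.mul_apply, hTρ h, hTρ g]) ((hTr _ _).trans (hTr _ _))
  have hmeas : ∀ g, Measurable (T g) := by
    intro g
    refine Measurable.subtype_mk (f := fun x => (T g x : X)) (h := fun x => (T g x).2) ?_
    intro B hB
    -- By uniqueness, T g x is any enumerated point of the class g·[x]_E with the r-value of x, so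
    -- its preimages are countable unions of Borel sets.
    have : (fun x => (T g x : X)) ⁻¹' B = Subtype.val ⁻¹' (⋃ n,
        ({x | ρ g (Quotient.mk E x) = Quotient.mk E (f n x)} ∩ {x | r (f n x) = r x}) ∩
          f n ⁻¹' B) := by
      ext x
      simp only [mem_preimage, mem_iUnion, mem_inter_iff, mem_ofPred_eq]
      constructor
      · intro h
        obtain ⟨n, hn⟩ := (hf x (T g x)).1 ⟨g, hTρ g x⟩
        exact ⟨n, by rw [hn]; exact ⟨⟨hTρ g x, hTr g x⟩, h⟩⟩
      · rintro ⟨n, ⟨h1, h2⟩, h3⟩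
        rw [huniq g x ⟨f n x, hYinv x _ ⟨g, h1⟩ x.2⟩ h1 h2]
        exact h3
    rw [this]
    exact measurable_subtype_coe (.iUnion fun n => ((measurable_id.prodMk (hfm n) (hρ g)).inter
      (measurableSet_eq_fun (hr.comp (hfm n)) hr)).inter (hfm n hB))
  have hrel : ∀ g (x y : Y), E x y ↔ E (T g x) (T g y) := by
    intro g x y
    have h : ∀ u v : X, Quotient.mk E u = Quotient.mk E v ↔ E u v := fun u v => Quotient.eq
    rw [← h, ← h, ← hTρ, ← hTρ, EmbeddingLike.apply_eq_iff_eq]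
  let A : G → borelAut (restrictRel E Y) := fun g =>
    ⟨⟨T g, T g⁻¹, fun x => by rw [← hmul, inv_mul_cancel, hone],
      fun x => by rw [← hmul, mul_inv_cancel, hone]⟩, hmeas g, hmeas g⁻¹, hrel g⟩
  refine ⟨MonoidHom.mk' A fun g h => Subtype.ext (Equiv.ext (hmul g h)), fun g x => ?_,
    fun g x h => ?_⟩
  · apply (quotientRestrictEquiv E Y).injective
    apply Subtype.ext
    rw [restrictAction_apply, quotientRestrictEquiv_mk, quotientRestrictEquiv_mk]
    exact hTρ g x
  · exact Subtype.ext (hinj _ _ h (hTr g x))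

end Lift

theorem corollary1p2 {X : Type*} [TopologicalSpace X] [PolishSpace X] [MeasurableSpace X]
    [BorelSpace X] (E : Setoid X) (hE : IsCBER E) (hap : IsAperiodicRel E)
    {G : Type*} [Group G] [Countable G]
    (ρ : G →* Equiv.Perm (Quotient E)) (hρ : IsBorelQuotientAction E ρ) :
    ∃ (Y : Set X) (hY : IsInvariantSet (veeRel E ρ) Y),
      Y ∈ residual X ∧ MeasurableSet Y ∧
        HasClassBijectiveLift (restrictRel E Y) (restrictAction E ρ Y hY) := by
  have hF := isCBER_veeRel hE hρ
  obtain ⟨f, hfm, hf⟩ := hF.exists_measurable_enumeration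
  obtain ⟨r, hr, hinj, hres, hmeas⟩ := exists_generic_link hE hap hF fun _ _ => veeRel_of_rel
  -- The condition on x depends only on its class under `veeRel E ρ`.
  have hY : IsInvariantSet (veeRel E ρ)
      {x | ∀ y z, veeRel E ρ x y → veeRel E ρ x z → ∃ w, E w z ∧ r w = r y} := by
    ext x
    refine ⟨fun hx => ⟨x, hx, (veeRel E ρ).refl x⟩, ?_⟩
    rintro ⟨x', hx', hxx'⟩ y z hy hz
    have hsymm := (veeRel E ρ).symm hxx'
    exact hx' y z ((veeRel E ρ).trans hsymm hy) ((veeRel E ρ).trans hsymm hz)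
  exact ⟨_, hY, hres, hmeas, hasClassBijectiveLift_of_link hρ hfm hf hr hinj hY
    fun x hx z hz => hx x z ((veeRel E ρ).refl x) hz⟩
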